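/- Let $N$ be a positive integer. Let $\mathbb P$ be the complex projective line, $P\in\mathbb P$ the point at infinity, $u$ the coordinate with its pole at $P$; points $z\neq P$ are identified with the complex numbers $u(z)$. Let $\kappa$ be a square root of the canonical bundle $K$, with its connection $\nabla$ such that $\nabla\sqrt{du}=0$; nonzero meromorphic sections of $\kappa$ are $\sigma=f\sqrt{du}$ with $f\in\mathbb C(u)^*$, and $\sigma^{-1}\nabla\sigma=f^{-1}df$. For $l\in\mathbb Z$ let $\mathcal K^*_l(\kappa)$ be the set of those $\sigma$ with $\mathrm{Res}_P(\sigma^{-1}\nabla\sigma)=l$. *States.* For a set $S\subset\mathbb P\setminus P$ let $\mathfrak m_P^S$ be the space of meromorphic functions that vanish at $P$ and are regular on $S$, $\mathbb W^S=\mathrm{Sym}(\mathfrak m_P^S)$, and let $\tilde{\mathbb W}^S_l$ be the space of maps $\rho$ from $\mathcal K_l^*(\kappa)$ to $\mathbb W^S$ with $\rho(t\sigma)=t^{Nl}\rho(\sigma)$ for $t\in\mathbb C^*$, nonzero on finitely many $\mathbb C^*$-orbits only, and vanishing on every $\sigma$ that is not regular and nonvanishing at all points of $S$. Put $\tilde{\mathbb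 W}^S=\bigoplus_l\tilde{\mathbb W}^S_l$, $\tilde{\mathbb W}=\tilde{\mathbb W}^{\emptyset}$, $\tilde{\mathbb W}^z=\tilde{\mathbb W}^{\{z\}}$, $\tilde{\mathbb W}^{z,z'}=\tilde{\mathbb W}^{\{z,z'\}}$. For $\sigma\in\mathcal K_l^*(\kappa)$ and $\mathtt v\in\mathbb W^S$, $\mathtt v\,\hat\otimes\,E[\sigma]$ denotes the map $t\sigma\mapsto t^{Nl}\mathtt v$ that is zero off $\mathbb C^*\sigma$. The operator of multiplication by $\alpha\in\mathfrak m_P^S$ is again written $\alpha$. Let $\digamma$ be the line spanned by $du$; values at $z\neq P$ of differentials are regarded as elements of $\digamma$. Lines $\kappa_z,\kappa_{z'},\digamma$ in tensor products are exchanged without sign. *Fields.* For $z\neq P$ the boson current is $j(z)=\iota(z)+\epsilon(z):\tilde{\mathbb W}^z\to\tilde{\mathbb W}\otimes\digamma$, where $\epsilon(z)$ is multiplication by $\frac{1}{u-u(z)}\otimes du$, and $\iota(z)$ is determined by $$[\iota(z),\alpha]=-d\alpha(z)\ (\alpha\in\mathfrak m_P^z),\qquad \iota(z)\,\mathbf 1\hat\otimes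 E[\sigma]=-\sqrt N\,(\sigma^{-1}\nabla\sigma)(z)\;\mathbf 1\hat\otimes E[\sigma].$$ For $\check\lambda\in\mathbb Z$ put $\lambda=\sqrt N\check\lambda$. The vertex operator $$V_\lambda(z)=\flat^+_\lambda(z)\,\flat^-_\lambda(z):\ \tilde{\mathbb W}^z_l\to\tilde{\mathbb W}_{l+\check\lambda}\otimes\kappa_z^{N\check\lambda}\otimes\digamma^{-N\check\lambda(l+\check\lambda)}$$ is the product of $\flat^-_\lambda(z)$, given by $[\flat^-_\lambda(z),\alpha]=-\lambda\,\alpha(z)\,\flat^-_\lambda(z)$ and $\flat^-_\lambda(z)\,\mathbf 1\hat\otimes E[\sigma]=\mathbf 1\hat\otimes E[\sigma]\;\sigma(z)^{N\check\lambda}$, and $\flat^+_\lambda(z)$, given by $[\flat^+_\lambda(z),\alpha]=0$ and $\flat^+_\lambda(z)\,\mathbf 1\hat\otimes E[\sigma]=\mathbf 1\hat\otimes E[(u-u(z))^{-\check\lambda}\sigma]\;du^{-N\check\lambda(l+\check\lambda)}$ for $\sigma\in\mathcal K^*_l(\kappa)$. (The two factors are applied representative by representative, that is, to maps that need not be equivariant;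 the product is well defined on $\tilde{\mathbb W}^z$.) For $z\ne z'$ these operators also map $\tilde{\mathbb W}^{z,z'}$ to $\tilde{\mathbb W}^{z'}$ (tensored with the lines), so that they can be composed on $\tilde{\mathbb W}^{z,z'}$. **Proposition.** Let $z\neq z'$ be points of $\mathbb P\setminus P$ and $\check\lambda,\check\lambda'\in\mathbb Z$, $\lambda=\sqrt N\check\lambda$, $\lambda'=\sqrt N\check\lambda'$. Then, on $\tilde{\mathbb W}^{z,z'}$, $$[j(z'),V_\lambda(z)]=0,\qquad V_{\lambda'}(z')V_\lambda(z)=(-1)^{\lambda\lambda'}\,V_\lambda(z)V_{\lambda'}(z'),$$ where $\lambda\lambda'=N\check\lambda\check\lambda'\in\mathbb Z$. In particular, for $N=1$ the fields $V_{\pm1}$ anticommute at distinct points: $V_{s'}(z')V_s(z)=-V_s(z)V_{s'}(z')$ for all $s,s'\in\{1,-1\}$. -/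

import Mathlib

open scoped TensorProduct

noncomputable section

namespace LatticeField

/-! The pair `(ℙ, P)` is the projective line with its point at infinity, and `u` is the coordinate
with its pole at `P`: meromorphic functions on `ℙ` are the elements of `RatFunc ℂ`, with
`u = RatFunc.X`, and a point `z ≠ P` is the complex number `u(z)`. -/

/-- The value at `z` of a meromorphic function regular at `z`. -/
abbrev evalAt (z : ℂ) (f : RatFunc ℂ) : ℂ := f.eval (RingHom.id ℂ) z

/-- The meromorphic function `f` is regular at the finite point `z`. -/
def RegularAt (z : ℂ) (f : RatFunc ℂ) : Prop := f.denom.eval z ≠ 0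

lemma RegularAt.add {z : ℂ} {f g : RatFunc ℂ} (hf : RegularAt z f) (hg : RegularAt z g) :
    RegularAt z (f + g) := by
  intro h
  have hd := Polynomial.eval_dvd (x := z) (RatFunc.denom_add_dvd f g)
  rw [h, zero_dvd_iff, Polynomial.eval_mul] at hd
  exact (mul_ne_zero hf hg) hd

lemma RegularAt.mul {z : ℂ} {f g : RatFunc ℂ} (hf : RegularAt z f) (hg : RegularAt z g) :
    RegularAt z (f * g) := by
  intro h
  have hd := Polynomial.eval_dvd (x := z) (RatFunc.denom_mul_dvd f g)
  rw [h, zero_dvd_iff, Polynomial.eval_mul] at hd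
  exact (mul_ne_zero hf hg) hd

lemma regularAt_C (z c : ℂ) : RegularAt z (RatFunc.C c) := by simp [RegularAt]

lemma evalAt_add {z : ℂ} {f g : RatFunc ℂ} (hf : RegularAt z f) (hg : RegularAt z g) :
    evalAt z (f + g) = evalAt z f + evalAt z g :=
  RatFunc.eval_add (RingHom.id ℂ) z hf hg

lemma evalAt_smul {z : ℂ} (c : ℂ) {f : RatFunc ℂ} (hf : RegularAt z f) :
    evalAt z (c • f) = c * evalAt z f := by
  rw [RatFunc.smul_eq_C_mul, evalAt, RatFunc.eval_mul (RingHom.id ℂ) z (regularAt_C z c) hf, RatFunc.eval_C]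
  rfl

lemma RegularAt.eventually {z : ℂ} {f : RatFunc ℂ} (hf : RegularAt z f) :
    ∀ᶠ w in nhds z, RegularAt w f :=
  f.denom.continuous.continuousAt.eventually_ne hf

lemma RegularAt.differentiableAt {z : ℂ} {f : RatFunc ℂ} (hf : RegularAt z f) :
    DifferentiableAt ℂ (fun w => evalAt w f) z :=
  f.num.differentiableAt.div f.denom.differentiableAt hf

/-- `𝔪_P^S`: the meromorphic functions that vanish at `P` (the point at infinity) and are regular at
every point of `S`. In particular `mP ∅` is `𝔪_P` and `mP {z}` is `𝔪_P^z`. -/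
def mP (S : Set ℂ) : Submodule ℂ (RatFunc ℂ) where
  carrier := {f | (f = 0 ∨ f.intDegree < 0) ∧ ∀ z ∈ S, RegularAt z f}
  zero_mem' := ⟨Or.inl rfl, fun z _ => by simp [RegularAt]⟩
  add_mem' := by
    rintro f g ⟨hf, hf'⟩ ⟨hg, hg'⟩
    refine ⟨?_, fun z hz => (hf' z hz).add (hg' z hz)⟩
    by_cases hfg : f + g = 0
    · exact Or.inl hfg
    rcases hf with rfl | hf
    · simpa using hg
    by_cases hg0 : g = 0
    · subst hg0
      right
      simpa using hf
    · have hg1 := hg.resolve_left hg0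
      exact Or.inr ((RatFunc.intDegree_add_le hg0 hfg).trans_lt (max_lt hf hg1))
  smul_mem' := by
    rintro c f ⟨hf, hf'⟩
    refine ⟨?_, fun z hz => ?_⟩
    · by_cases hc : c = 0
      · left
        simp [hc]
      rcases hf with rfl | hf
      · left
        simp
      by_cases hf0 : f = 0
      · left
        simp [hf0]
      right
      have hC : RatFunc.C c ≠ (0 : RatFunc ℂ) := by simpa using hc
      rw [RatFunc.smul_eq_C_mul, RatFunc.intDegree_mul hC hf0, RatFunc.intDegree_C]
      simpa using hf
    · rw [RatFunc.smul_eq_C_mul]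
      exact (regularAt_C z c).mul (hf' z hz)

/-- `1 / (u - u(z))` as an element of `𝔪_P^T`, for `z ∉ T`. -/
def pole (z : ℂ) {T : Set ℂ} (hz : z ∉ T) : mP T :=
  ⟨(RatFunc.X - RatFunc.C z)⁻¹, by
    have hX : (RatFunc.X - RatFunc.C z : RatFunc ℂ) =
        algebraMap (Polynomial ℂ) (RatFunc ℂ) (Polynomial.X - Polynomial.C z) := by simp
    refine ⟨Or.inr ?_, fun w hw h => ?_⟩
    · rw [hX, RatFunc.intDegree_inv, RatFunc.intDegree_polynomial]
      simp
    · have hd : (RatFunc.X - RatFunc.C z : RatFunc ℂ)⁻¹.denom ∣ Polynomial.X - Polynomial.C z := by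
        rw [hX, RatFunc.denom_dvd (Polynomial.X_sub_C_ne_zero z)]
        exact ⟨1, by simp⟩
      have he := Polynomial.eval_dvd (x := w) hd
      rw [h, zero_dvd_iff] at he
      have hwz : w = z := by simpa [sub_eq_zero] using he
      exact hz (hwz ▸ hw)⟩

/-- `α ↦ α(z)` on `𝔪_P^S`, for `z ∈ S`. -/
def valueAt {S : Set ℂ} (z : ℂ) (hz : z ∈ S) : mP S →ₗ[ℂ] ℂ where
  toFun α := evalAt z α
  map_add' α β := evalAt_add (α.2.2 z hz) (β.2.2 z hz)
  map_smul' c α := evalAt_smul c (α.2.2 z hz)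

/-- `α ↦ dα(z)` on `𝔪_P^S`, for `z ∈ S`, as a multiple of `du`. -/
def differentialAt {S : Set ℂ} (z : ℂ) (hz : z ∈ S) : mP S →ₗ[ℂ] ℂ where
  toFun α := deriv (fun w => evalAt w α) z
  map_add' α β := by
    have hα := α.2.2 z hz
    have hβ := β.2.2 z hz
    rw [← deriv_fun_add hα.differentiableAt hβ.differentiableAt]
    apply Filter.EventuallyEq.deriv_eq
    filter_upwards [hα.eventually, hβ.eventually] with w h1 h2
    exact evalAt_add h1 h2
  map_smul' c α := by
    have hα := α.2.2 z hz
    have h : deriv (fun w => c * evalAt w (α : RatFunc ℂ)) z =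
        c * deriv (fun w => evalAt w (α : RatFunc ℂ)) z :=
      deriv_const_mul _ hα.differentiableAt
    rw [RingHom.id_apply, smul_eq_mul, ← h]
    apply Filter.EventuallyEq.deriv_eq
    filter_upwards [hα.eventually] with w h1
    exact evalAt_smul c h1

/-- `𝕎^S = Sym(𝔪_P^S)`. -/
abbrev W (S : Set ℂ) : Type := SymmetricAlgebra ℂ (mP S)

/-- The map `𝕎^S → 𝕎^T` induced by the inclusion of `𝔪_P^S` in `𝔪_P^T`, for `T ⊆ S`. -/
def W.incl {S T : Set ℂ} (h : T ⊆ S) : W S →ₐ[ℂ] W T :=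
  SymmetricAlgebra.lift (SymmetricAlgebra.ι ℂ (mP T) ∘ₗ
    Submodule.inclusion (fun _ hf => ⟨hf.1, fun z hz => hf.2 z (h hz)⟩))

/-- The automorphism of `𝕎^S` that sends `α ∈ 𝔪_P^S` to `α - c α(z)`. -/
def W.shift {S : Set ℂ} (c : ℂ) (z : ℂ) (hz : z ∈ S) : W S →ₐ[ℂ] W S :=
  SymmetricAlgebra.lift (SymmetricAlgebra.ι ℂ (mP S) -
    c • (Algebra.linearMap ℂ (W S) ∘ₗ valueAt z hz))

/-- The derivation of `Sym M` that extends a linear form `φ` on `M`; it is the coefficient of the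
infinitesimal in the algebra homomorphism `m ↦ m + φ(m) ε`, with `ε ^ 2 = 0`. -/
def symDer {M : Type} [AddCommGroup M] [Module ℂ M] (φ : M →ₗ[ℂ] ℂ) :
    SymmetricAlgebra ℂ M →ₗ[ℂ] SymmetricAlgebra ℂ M :=
  (TrivSqZeroExt.sndHom (SymmetricAlgebra ℂ M) (SymmetricAlgebra ℂ M)).restrictScalars ℂ ∘ₗ
    (SymmetricAlgebra.lift
      ((TrivSqZeroExt.inlAlgHom ℂ (SymmetricAlgebra ℂ M) (SymmetricAlgebra ℂ M)).toLinearMap ∘ₗ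
          SymmetricAlgebra.ι ℂ M +
        (TrivSqZeroExt.inrHom (SymmetricAlgebra ℂ M) (SymmetricAlgebra ℂ M)).restrictScalars ℂ ∘ₗ
          Algebra.linearMap ℂ (SymmetricAlgebra ℂ M) ∘ₗ φ)).toLinearMap

lemma symDer_one {M : Type} [AddCommGroup M] [Module ℂ M] (φ : M →ₗ[ℂ] ℂ) : symDer φ 1 = 0 := by
  simp [symDer]

lemma symDer_ι_mul {M : Type} [AddCommGroup M] [Module ℂ M] (φ : M →ₗ[ℂ] ℂ) (m : M)
    (x : SymmetricAlgebra ℂ M) :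
    symDer φ (SymmetricAlgebra.ι ℂ M m * x) = SymmetricAlgebra.ι ℂ M m * symDer φ x + φ m • x := by
  have key : ∀ y : SymmetricAlgebra ℂ M, (SymmetricAlgebra.lift
      ((TrivSqZeroExt.inlAlgHom ℂ (SymmetricAlgebra ℂ M) (SymmetricAlgebra ℂ M)).toLinearMap ∘ₗ
          SymmetricAlgebra.ι ℂ M +
        (TrivSqZeroExt.inrHom (SymmetricAlgebra ℂ M) (SymmetricAlgebra ℂ M)).restrictScalars ℂ ∘ₗ
          Algebra.linearMap ℂ (SymmetricAlgebra ℂ M) ∘ₗ φ) y).fst = y := by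
    intro y
    have : (TrivSqZeroExt.fstHom ℂ (SymmetricAlgebra ℂ M) (SymmetricAlgebra ℂ M)).comp
      (SymmetricAlgebra.lift
      ((TrivSqZeroExt.inlAlgHom ℂ (SymmetricAlgebra ℂ M) (SymmetricAlgebra ℂ M)).toLinearMap ∘ₗ
          SymmetricAlgebra.ι ℂ M +
        (TrivSqZeroExt.inrHom (SymmetricAlgebra ℂ M) (SymmetricAlgebra ℂ M)).restrictScalars ℂ ∘ₗ
          Algebra.linearMap ℂ (SymmetricAlgebra ℂ M) ∘ₗ φ)) = AlgHom.id ℂ _ := by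
      apply SymmetricAlgebra.algHom_ext
      ext m
      simp
    exact DFunLike.congr_fun this y
  have h0 : ∀ y : SymmetricAlgebra ℂ M, TrivSqZeroExt.fst
      (algebraMap (SymmetricAlgebra ℂ M) (TrivSqZeroExt (SymmetricAlgebra ℂ M)
        (SymmetricAlgebra ℂ M)) y) = y := fun y => rfl
  simp [symDer, key, Algebra.smul_def, h0]

/-- The direct sum of all the lines `⨂_z κ_z ^ (m z) ⊗ Ϝ ^ n` (`m : ℂ →₀ ℤ`, `n : ℤ`), as a
commutative algebra under the tensor product, where lines are exchanged without sign. Here `κ_z` is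
the fibre of `κ` at `z` and `Ϝ` is the line of differentials that are regular and nowhere vanishing
away from `P`, together with zero. -/
abbrev Lines : Type := AddMonoidAlgebra ℂ ((ℂ →₀ ℤ) × ℤ)

/-- The basis vector `(√du)_z ^ m` of `κ_z ^ m`. -/
def sqrtDu (z : ℂ) (m : ℤ) : Lines := AddMonoidAlgebra.single (Finsupp.single z m, 0) 1

/-- The basis vector `du ^ n` of `Ϝ ^ n`. -/
def du (n : ℤ) : Lines := AddMonoidAlgebra.single (0, n) 1

/-- `𝕎^S` with coefficients in the lines. -/
abbrev WL (S : Set ℂ) : Type := W S ⊗[ℂ] Lines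

/-- The inclusion of `𝕎^S` in `𝕎^T`, with coefficients in the lines. -/
def WL.incl {S T : Set ℂ} (h : T ⊆ S) : WL S →ₐ[ℂ] WL T :=
  Algebra.TensorProduct.map (W.incl h) (AlgHom.id ℂ Lines)

/-- The set `𝒦^*(κ)` of nonzero meromorphic sections of `κ`: the nonzero meromorphic function `f`
stands for the section `σ = f √du`. As `∇√du = 0`, `σ⁻¹∇σ = f⁻¹ df`. -/
abbrev Sec : Type := (RatFunc ℂ)ˣ

/-- The constant section multiplier `t ∈ ℂ^*`. -/
def scalar : ℂˣ →* Sec := Units.map (algebraMap ℂ (RatFunc ℂ)).toMonoidHom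

/-- The function `u - u(z)`. -/
def coordSub (z : ℂ) : Sec :=
  Units.mk0 (RatFunc.X - RatFunc.C z) (by
    have hX : (RatFunc.X - RatFunc.C z : RatFunc ℂ) =
        algebraMap (Polynomial ℂ) (RatFunc ℂ) (Polynomial.X - Polynomial.C z) := by simp
    rw [hX]
    exact RatFunc.algebraMap_ne_zero (Polynomial.X_sub_C_ne_zero z))

/-- `χ_P(σ) = Res_P(σ⁻¹∇σ)`, the residue at infinity of `f⁻¹ df`. -/
def charge (σ : Sec) : ℤ := -(σ : RatFunc ℂ).intDegree

lemma charge_mul (σ τ : Sec) : charge (σ * τ) = charge σ + charge τ := by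
  simp only [charge, Units.val_mul, RatFunc.intDegree_mul σ.ne_zero τ.ne_zero]
  ring

lemma charge_scalar (t : ℂˣ) : charge (scalar t) = 0 := by
  have h : ((scalar t : Sec) : RatFunc ℂ) = RatFunc.C (t : ℂ) := rfl
  rw [charge, h, RatFunc.intDegree_C, neg_zero]

lemma charge_coordSub_zpow (z : ℂ) (a : ℤ) : charge (coordSub z ^ a) = -a := by
  have h1 : charge (coordSub z) = -1 := by
    have hX : ((coordSub z : Sec) : RatFunc ℂ) =
        algebraMap (Polynomial ℂ) (RatFunc ℂ) (Polynomial.X - Polynomial.C z) := by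
      simp [coordSub]
    rw [charge, hX, RatFunc.intDegree_polynomial]
    simp
  have h0 : charge 1 = 0 := by simp [charge]
  have hn : ∀ n : ℕ, charge (coordSub z ^ n) = -n := by
    intro n
    induction n with
    | zero => simp [h0]
    | succ n ih => rw [pow_succ, charge_mul, ih, h1]; push_cast; ring
  cases a with
  | ofNat n => simpa using hn n
  | negSucc n =>
    have h2 := charge_mul (coordSub z ^ (n + 1)) (coordSub z ^ (n + 1))⁻¹
    rw [mul_inv_cancel, h0, hn] at h2
    rw [zpow_negSucc, Int.negSucc_eq]
    push_cast at h2
    linarith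

/-- The section `σ` is regular and nonvanishing at `z`. -/
def RegNonvanishing (z : ℂ) (σ : Sec) : Prop :=
  (σ : RatFunc ℂ).denom.eval z ≠ 0 ∧ (σ : RatFunc ℂ).num.eval z ≠ 0

lemma RegNonvanishing.mul {z : ℂ} {σ τ : Sec} (hσ : RegNonvanishing z σ)
    (hτ : RegNonvanishing z τ) : RegNonvanishing z (σ * τ) := by
  constructor
  · exact RegularAt.mul (z := z) hσ.1 hτ.1
  · intro h
    have hd := Polynomial.eval_dvd (x := z) (RatFunc.num_mul_dvd (σ : RatFunc ℂ) τ)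
    rw [← Units.val_mul, h, zero_dvd_iff, Polynomial.eval_mul] at hd
    exact (mul_ne_zero hσ.2 hτ.2) hd

lemma RegNonvanishing.inv {z : ℂ} {σ : Sec} (hσ : RegNonvanishing z σ) :
    RegNonvanishing z σ⁻¹ := by
  have h0 : (σ : RatFunc ℂ).num ≠ 0 := RatFunc.num_ne_zero σ.ne_zero
  have hinv : ((σ⁻¹ : Sec) : RatFunc ℂ) = algebraMap (Polynomial ℂ) (RatFunc ℂ)
      (σ : RatFunc ℂ).denom / algebraMap (Polynomial ℂ) (RatFunc ℂ) (σ : RatFunc ℂ).num := by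
    rw [Units.val_inv_eq_inv_val]
    conv_lhs => rw [← RatFunc.num_div_denom (σ : RatFunc ℂ)]
    rw [inv_div]
  constructor
  · intro h
    have hd := Polynomial.eval_dvd (x := z)
      (RatFunc.denom_div_dvd (σ : RatFunc ℂ).denom (σ : RatFunc ℂ).num)
    rw [← hinv, h, zero_dvd_iff] at hd
    exact hσ.2 hd
  · intro h
    have hd := Polynomial.eval_dvd (x := z)
      (RatFunc.num_div_dvd (σ : RatFunc ℂ).denom h0)
    rw [← hinv, h, zero_dvd_iff] at hd
    exact hσ.1 hd

lemma regNonvanishing_coordSub_zpow {z w : ℂ} (h : w ≠ z) (a : ℤ) :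
    RegNonvanishing w (coordSub z ^ a) := by
  have h1 : RegNonvanishing w (coordSub z) := by
    have hX : ((coordSub z : Sec) : RatFunc ℂ) =
        algebraMap (Polynomial ℂ) (RatFunc ℂ) (Polynomial.X - Polynomial.C z) := by
      simp [coordSub]
    constructor
    · rw [hX, RatFunc.denom_algebraMap]
      simp
    · rw [hX, RatFunc.num_algebraMap]
      simpa [sub_eq_zero] using h
  have hn : ∀ n : ℕ, RegNonvanishing w (coordSub z ^ n) := by
    intro n
    induction n with
    | zero => simp [RegNonvanishing]
    | succ n ih => rw [pow_succ]; exact ih.mul h1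
  cases a with
  | ofNat n => simpa using hn n
  | negSucc n => rw [zpow_negSucc]; exact (hn _).inv

/-- Maps from nonzero meromorphic sections of `κ` to `𝕎^S`, with coefficients in the lines. -/
abbrev Maps (S : Set ℂ) : Type := Sec → WL S

/-- `W̃^S = ⨁_l W̃_l^S` with coefficients in the lines: maps `ρ` with
`ρ(tσ) = t ^ (N l) ρ(σ)` for `σ ∈ 𝒦_l^*(κ)` and `t ∈ ℂ^*`, that are nonzero on finitely many
`ℂ^*`-orbits only (the orbits are the fibres of `σ ↦ σ⁻¹∇σ`), and that live on the sections that
are regular and nonvanishing at the points of `S`. In particular `State N ∅` is `W̃` and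
`State N {z}` is `W̃^z`. -/
def State (N : ℕ) (S : Set ℂ) : Submodule ℂ (Maps S) where
  carrier := {ρ |
    (∀ (t : ℂˣ) (σ : Sec), ρ (scalar t * σ) = ((t : ℂ) ^ ((N : ℤ) * charge σ)) • ρ σ) ∧
    (∃ F : Finset Sec, ∀ σ, ρ σ ≠ 0 → ∃ τ ∈ F, ∃ t : ℂˣ, σ = scalar t * τ) ∧
    ∀ σ, ρ σ ≠ 0 → ∀ z ∈ S, RegNonvanishing z σ}
  zero_mem' := ⟨by simp, ⟨∅, by simp⟩, by simp⟩
  add_mem' := by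
    classical
    rintro ρ₁ ρ₂ ⟨h1, ⟨F1, hF1⟩, h1'⟩ ⟨h2, ⟨F2, hF2⟩, h2'⟩
    have hor : ∀ σ, (ρ₁ + ρ₂) σ ≠ 0 → ρ₁ σ ≠ 0 ∨ ρ₂ σ ≠ 0 := by
      intro σ h
      by_contra! hc
      exact h (by simp [hc.1, hc.2])
    refine ⟨fun t σ => by simp [h1 t σ, h2 t σ], ⟨F1 ∪ F2, fun σ h => ?_⟩, fun σ h => ?_⟩
    · rcases hor σ h with h | h
      · obtain ⟨τ, hτ, t, ht⟩ := hF1 σ h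
        exact ⟨τ, by simp [hτ], t, ht⟩
      · obtain ⟨τ, hτ, t, ht⟩ := hF2 σ h
        exact ⟨τ, by simp [hτ], t, ht⟩
    · rcases hor σ h with h | h
      · exact h1' σ h
      · exact h2' σ h
  smul_mem' := by
    rintro c ρ ⟨h1, ⟨F, hF⟩, h2⟩
    have hne : ∀ σ, (c • ρ) σ ≠ 0 → ρ σ ≠ 0 := by
      intro σ h hc
      exact h (by simp [hc])
    exact ⟨fun t σ => by simp [h1 t σ, smul_comm c], ⟨F, fun σ h => hF σ (hne σ h)⟩,
      fun σ h => h2 σ (hne σ h)⟩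

/-- A linear operator on values, depending on the section `σ` only through its `ℂ^*`-orbit, acts
on states. -/
lemma State.mem_of_pointwise {N : ℕ} {S T : Set ℂ} (hT : T ⊆ S) (L : Sec → WL S →ₗ[ℂ] WL T)
    (hL : ∀ (t : ℂˣ) σ, L (scalar t * σ) = L σ) (ρ : State N S) :
    (fun σ => L σ ((ρ : Maps S) σ)) ∈ State N T := by
  obtain ⟨ρ, h1, ⟨F, hF⟩, h2⟩ := ρ
  have hne : ∀ σ, L σ (ρ σ) ≠ 0 → ρ σ ≠ 0 := by
    intro σ h hc
    exact h (by simp [hc])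
  exact ⟨fun t σ => by simp [hL, h1 t σ], ⟨F, fun σ h => hF σ (hne σ h)⟩,
    fun σ h z hz => h2 σ (hne σ h) z (hT hz)⟩

/-- `λ = √N λ̌`. -/
def lam (N : ℕ) (a : ℤ) : ℂ := ((Real.sqrt N : ℝ) : ℂ) * a

/-- `b_{l,λ̌} = -N λ̌ (l + λ̌)`. -/
def bExp (N : ℕ) (l a : ℤ) : ℤ := -((N : ℤ) * a * (l + a))

/-- The field `ε(z) : W̃^S → W̃^T ⊗ Ϝ`: multiplication by `1 / (u - u(z)) ⊗ du`. -/
def epsilonField (N : ℕ) (z : ℂ) {S T : Set ℂ} (hT : T ⊆ S) (hzT : z ∉ T) :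
    State N S →ₗ[ℂ] State N T where
  toFun ρ := ⟨fun σ => (SymmetricAlgebra.ι ℂ (mP T) (pole z hzT) ⊗ₜ[ℂ] du 1) *
      WL.incl hT ((ρ : Maps S) σ),
    State.mem_of_pointwise hT
      (fun _ => LinearMap.mulLeft ℂ (SymmetricAlgebra.ι ℂ (mP T) (pole z hzT) ⊗ₜ[ℂ] du 1) ∘ₗ
        (WL.incl hT).toLinearMap) (fun _ _ => rfl) ρ⟩
  map_add' ρ₁ ρ₂ := by
    ext σ
    simp [mul_add]
  map_smul' c ρ := by
    ext σ
    simp [-Algebra.mul_smul_comm, mul_smul_comm]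

/-- `(σ⁻¹∇σ)(z)`, as a multiple of `du`, for `σ` regular and nonvanishing at `z`. -/
def logDerivAt (z : ℂ) (σ : Sec) : ℂ := logDeriv (fun w => evalAt w (σ : RatFunc ℂ)) z

lemma scalar_smul (t : ℂˣ) (σ : Sec) (w : ℂ) :
    evalAt w ((scalar t * σ : Sec) : RatFunc ℂ) = t * evalAt w (σ : RatFunc ℂ) := by
  have h : ((scalar t * σ : Sec) : RatFunc ℂ) = RatFunc.C (t : ℂ) * (σ : RatFunc ℂ) := rfl
  rw [h]
  by_cases hw : RegularAt w (σ : RatFunc ℂ)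
  · rw [← RatFunc.smul_eq_C_mul]
    exact evalAt_smul _ hw
  · have hw' : ¬ RegularAt w (RatFunc.C (t : ℂ) * (σ : RatFunc ℂ)) := by
      intro hr
      apply hw
      have := (regularAt_C w (t : ℂ)⁻¹).mul hr
      rwa [← mul_assoc, ← map_mul, inv_mul_cancel₀ t.ne_zero, map_one, one_mul] at this
    have e1 : evalAt w (σ : RatFunc ℂ) = 0 :=
      RatFunc.eval_eq_zero_of_eval₂_denom_eq_zero (not_not.mp hw)
    have e2 : evalAt w (RatFunc.C (t : ℂ) * (σ : RatFunc ℂ)) = 0 :=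
      RatFunc.eval_eq_zero_of_eval₂_denom_eq_zero (not_not.mp hw')
    rw [e1, e2, mul_zero]

lemma logDerivAt_scalar (z : ℂ) (t : ℂˣ) (σ : Sec) :
    logDerivAt z (scalar t * σ) = logDerivAt z σ := by
  have h : (fun w => evalAt w ((scalar t * σ : Sec) : RatFunc ℂ)) =
      fun w => (t : ℂ) * evalAt w (σ : RatFunc ℂ) := funext fun w => scalar_smul t σ w
  rw [logDerivAt, logDerivAt, h]
  exact logDeriv_const_mul z _ t.ne_zero

/-- The values of `ι(z)` at a given section: the operator `D - √N (σ⁻¹∇σ)(z)` times `du`, where `D`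
is the derivation of `𝕎^S` with `D(α) = -dα(z)`. -/
def iotaValue (N : ℕ) (z : ℂ) {S : Set ℂ} (hz : z ∈ S) (σ : Sec) : WL S →ₗ[ℂ] WL S :=
  LinearMap.mulLeft ℂ ((1 : W S) ⊗ₜ[ℂ] du 1) ∘ₗ
    (LinearMap.rTensor Lines (symDer (-(differentialAt z hz))) -
      (((Real.sqrt N : ℝ) : ℂ) * logDerivAt z σ) • LinearMap.id)

/-- The field `ι(z) : W̃^S → W̃^T ⊗ Ϝ`, determined by `[ι(z), α] = -dα(z)` and
`ι(z)(1 ⊗ E[σ]) = -(1 ⊗ E[σ]) √N (σ⁻¹∇σ)(z)`. -/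
def iotaField (N : ℕ) (z : ℂ) {S T : Set ℂ} (hz : z ∈ S) (hT : T ⊆ S) :
    State N S →ₗ[ℂ] State N T where
  toFun ρ := ⟨fun σ => WL.incl hT (iotaValue N z hz σ ((ρ : Maps S) σ)),
    State.mem_of_pointwise hT (fun σ => (WL.incl hT).toLinearMap ∘ₗ iotaValue N z hz σ)
      (fun t σ => by simp [iotaValue, logDerivAt_scalar]) ρ⟩
  map_add' ρ₁ ρ₂ := by
    ext σ
    simp
  map_smul' c ρ := by
    ext σ
    simp

/-- The boson current `j(z) = ι(z) + ε(z) : W̃^S → W̃^T ⊗ Ϝ`, for `z ∈ S` and `T ⊆ S` with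
`z ∉ T`. -/
def current (N : ℕ) (z : ℂ) {S T : Set ℂ} (hz : z ∈ S) (hT : T ⊆ S) (hzT : z ∉ T) :
    State N S →ₗ[ℂ] State N T :=
  iotaField N z hz hT + epsilonField N z hT hzT

/-- `♭⁻_λ(z)`, with `[♭⁻_λ(z), α] = -λ α(z) ♭⁻_λ(z)` and
`♭⁻_λ(z) (1 ⊗ E[σ]) = 1 ⊗ E[σ] σ(z) ^ (N λ̌)`. It is defined on all maps, equivariant or not; it
takes a state of `W̃_l` to a map which is equivariant for the exponent `N (l + λ̌)`. -/
def flatMinus (N : ℕ) (a : ℤ) (z : ℂ) {S : Set ℂ} (hz : z ∈ S) : Maps S →ₗ[ℂ] Maps S where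
  toFun ρ := fun σ =>
    ((1 : W S) ⊗ₜ[ℂ] ((evalAt z (σ : RatFunc ℂ) ^ ((N : ℤ) * a)) • sqrtDu z ((N : ℤ) * a))) *
      Algebra.TensorProduct.map (W.shift (lam N a) z hz) (AlgHom.id ℂ Lines) (ρ σ)
  map_add' ρ₁ ρ₂ := by
    ext σ
    simp [mul_add]
  map_smul' c ρ := by
    ext σ
    simp [-Algebra.mul_smul_comm, mul_smul_comm]

/-- `♭⁺_λ(z)`, which commutes with every `α`, and sends `1 ⊗ E[σ]` to
`1 ⊗ E[(u - u(z)) ^ (-λ̌) σ] du ^ b_{l,λ̌}` for `σ ∈ 𝒦_l^*(κ)`: the value at `τ` of the image comes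
from the value at the section `σ` with `τ = (u - u(z)) ^ (-λ̌) σ`. -/
def flatPlus (N : ℕ) (a : ℤ) (z : ℂ) {S : Set ℂ} : Maps S →ₗ[ℂ] Maps S where
  toFun ρ := fun τ =>
    ((1 : W S) ⊗ₜ[ℂ] du (bExp N (charge (coordSub z ^ a * τ)) a)) * ρ (coordSub z ^ a * τ)
  map_add' ρ₁ ρ₂ := by
    ext σ
    simp [mul_add]
  map_smul' c ρ := by
    ext σ
    simp [-Algebra.mul_smul_comm, mul_smul_comm]

/-- The product `♭⁺_λ(z) ♭⁻_λ(z)` preserves the equivariance of states. -/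
lemma flat_mem (N : ℕ) (a : ℤ) (z : ℂ) {S T : Set ℂ} (hz : z ∈ S) (hT : T ⊆ S) (hzT : z ∉ T)
    (ρ : State N S) :
    (fun τ => WL.incl hT (flatPlus N a z (flatMinus N a z hz (ρ : Maps S)) τ)) ∈ State N T := by
  classical
  obtain ⟨ρ, h1, ⟨F, hF⟩, h2⟩ := ρ
  have hne : ∀ τ, WL.incl hT (flatPlus N a z (flatMinus N a z hz ρ) τ) ≠ 0 →
      ρ (coordSub z ^ a * τ) ≠ 0 := by
    intro τ h hc
    exact h (by simp [flatPlus, flatMinus, hc])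
  refine ⟨fun t τ => ?_, ⟨F.image (fun σ => coordSub z ^ (-a) * σ), fun τ h => ?_⟩,
    fun τ h w hw => ?_⟩
  · have hcomm : coordSub z ^ a * (scalar t * τ) = scalar t * (coordSub z ^ a * τ) :=
      mul_left_comm _ _ _
    have hch : (N : ℤ) * charge τ = (N : ℤ) * a + (N : ℤ) * charge (coordSub z ^ a * τ) := by
      rw [charge_mul, charge_coordSub_zpow]
      ring
    have hch' : charge (scalar t * (coordSub z ^ a * τ)) = charge (coordSub z ^ a * τ) := by
      rw [charge_mul, charge_scalar, zero_add]
    rw [← map_smul]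
    simp only [flatPlus, flatMinus, LinearMap.coe_mk, AddHom.coe_mk]
    rw [hcomm, hch', h1, scalar_smul, mul_zpow, hch, zpow_add₀ t.ne_zero]
    simp only [map_smul, mul_smul, TensorProduct.tmul_smul, smul_mul_assoc, mul_smul_comm]
    exact smul_comm _ _ _
  · obtain ⟨σ, hσ, t, ht⟩ := hF _ (hne τ h)
    refine ⟨coordSub z ^ (-a) * σ, Finset.mem_image_of_mem _ hσ, t, ?_⟩
    rw [mul_left_comm, ← ht, ← mul_assoc, ← zpow_add]
    simp
  · have hr := h2 _ (hne τ h) w (hT hw)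
    have hwz : w ≠ z := fun hc => hzT (hc ▸ hw)
    have := (regNonvanishing_coordSub_zpow hwz (-a)).mul hr
    rwa [← mul_assoc, ← zpow_add, neg_add_cancel, zpow_zero, one_mul] at this

/-- The vertex operator `V_λ(z) = ♭⁺_λ(z) ♭⁻_λ(z)`, `λ = √N λ̌`, on `W̃^S` with values in `W̃^T`, for
`z ∈ S` and `T ⊆ S` with `z ∉ T`. It takes `W̃_l^S` to
`W̃_{l + λ̌}^T ⊗ κ_z ^ (N λ̌) ⊗ Ϝ ^ (-N λ̌ (l + λ̌))`. -/
def vertexOp (N : ℕ) (a : ℤ) (z : ℂ) {S T : Set ℂ} (hz : z ∈ S) (hT : T ⊆ S) (hzT : z ∉ T) :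
    State N S →ₗ[ℂ] State N T where
  toFun ρ := ⟨fun τ => WL.incl hT (flatPlus N a z (flatMinus N a z hz (ρ : Maps S)) τ),
    flat_mem N a z hz hT hzT ρ⟩
  map_add' ρ₁ ρ₂ := by
    ext σ
    simp
  map_smul' c ρ := by
    ext σ
    simp

end LatticeField

end

noncomputable section

namespace LatticeField

/-! ### Values and logarithmic derivatives of sections -/

/-! At a fixed section a vertex operator does three things (`vertexOp_apply`): it reads the state at
a section multiplied by a power of `u - z`, applies the algebra homomorphism `α ↦ α - λ α(z)`, and
multiplies by a coefficient in the lines. For two vertex operators at distinct points the section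
factors commute, and so do the homomorphisms, since each only subtracts constants
(`WL.shiftIncl_comm`). Everything therefore rests on the coefficients (`vertexCoeff_comm`). If the
state is read at `σ`, the operator applied second evaluates a section already divided by a power of
`u - z` or `u - z'`. This yields `(z' - z) ^ (-N a a')` in one order and `(z - z') ^ (-N a a')` in
the other; their ratio is the sign. The powers of `du` agree.

For the current, the derivation in `ι(z')` commutes with the homomorphism, because constants have
zero differential (`WL.symDer_shiftIncl`). The remaining part of `j(z')` is multiplication by `1 /
(u - z') - √N (σ⁻¹∇σ)(z')`. The homomorphism changes the first term and the division of `σ` by `(u -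
z) ^ a` changes the second, by amounts that cancel because `λ = √N a`. -/

lemma RegNonvanishing.evalAt_ne_zero {z : ℂ} {σ : Sec} (hσ : RegNonvanishing z σ) :
    evalAt z (σ : RatFunc ℂ) ≠ 0 :=
  div_ne_zero hσ.2 hσ.1

lemma RegNonvanishing.eventually {z : ℂ} {σ : Sec} (hσ : RegNonvanishing z σ) :
    ∀ᶠ w in nhds z, RegNonvanishing w σ :=
  ((σ : RatFunc ℂ).denom.continuous.continuousAt.eventually_ne hσ.1).and
    ((σ : RatFunc ℂ).num.continuous.continuousAt.eventually_ne hσ.2)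

lemma RegNonvanishing.evalAt_mul {z : ℂ} {σ τ : Sec} (hσ : RegNonvanishing z σ)
    (hτ : RegNonvanishing z τ) :
    evalAt z ((σ * τ : Sec) : RatFunc ℂ) = evalAt z (σ : RatFunc ℂ) * evalAt z (τ : RatFunc ℂ) :=
  RatFunc.eval_mul (RingHom.id ℂ) z hσ.1 hτ.1

lemma regNonvanishing_one (z : ℂ) : RegNonvanishing z 1 := by simp [RegNonvanishing]

/-- The group of sections that are regular and nonvanishing at `z`. -/
def nonvanishingAt (z : ℂ) : Subgroup Sec where
  carrier := {σ | RegNonvanishing z σ}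
  one_mem' := regNonvanishing_one z
  mul_mem' := RegNonvanishing.mul
  inv_mem' := RegNonvanishing.inv

/-- The value at `z`, as a homomorphism on the sections regular and nonvanishing at `z`. -/
def evalHom (z : ℂ) : nonvanishingAt z →* ℂ where
  toFun σ := evalAt z ((σ : Sec) : RatFunc ℂ)
  map_one' := RatFunc.eval_one _ _
  map_mul' σ τ := σ.2.evalAt_mul τ.2

lemma evalAt_coordSub_zpow {z w : ℂ} (h : w ≠ z) (a : ℤ) :
    evalAt w ((coordSub z ^ a : Sec) : RatFunc ℂ) = (w - z) ^ a := by
  have h1 : RegNonvanishing w (coordSub z) := by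
    simpa using regNonvanishing_coordSub_zpow h 1
  have h2 : evalAt w ((coordSub z : Sec) : RatFunc ℂ) = w - z := by
    have hX : ((coordSub z : Sec) : RatFunc ℂ) =
        algebraMap (Polynomial ℂ) (RatFunc ℂ) (Polynomial.X - Polynomial.C z) := by
      simp [coordSub]
    rw [hX, evalAt, RatFunc.eval_algebraMap]
    simp
  -- Evaluation is not multiplicative on all rational functions, but it is on this subgroup, where
  -- negative powers come for free.
  have h3 := map_zpow (evalHom w) ⟨coordSub z, h1⟩ a
  rw [← h2]
  exact h3

/-- Carries the support condition from the section at which the input state is read to the section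
at which the output is evaluated. -/
lemma RegNonvanishing.of_coordSub_zpow_mul {z w : ℂ} (h : w ≠ z) {a : ℤ} {τ : Sec}
    (hτ : RegNonvanishing w (coordSub z ^ a * τ)) : RegNonvanishing w τ := by
  simpa using (regNonvanishing_coordSub_zpow h a).inv.mul hτ

lemma logDerivAt_mul {z : ℂ} {σ τ : Sec} (hσ : RegNonvanishing z σ) (hτ : RegNonvanishing z τ) :
    logDerivAt z (σ * τ) = logDerivAt z σ + logDerivAt z τ := by
  -- The product rule for values may fail at points where a factor has a pole, so the two functions
  -- are compared only near `z`.
  have h : (fun w => evalAt w ((σ * τ : Sec) : RatFunc ℂ)) =ᶠ[nhds z]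
      fun w => evalAt w (σ : RatFunc ℂ) * evalAt w (τ : RatFunc ℂ) := by
    filter_upwards [hσ.eventually, hτ.eventually] with w h1 h2
    exact h1.evalAt_mul h2
  rw [logDerivAt, (logDeriv_congr_nhds h).self_of_nhds]
  exact logDeriv_mul z hσ.evalAt_ne_zero hτ.evalAt_ne_zero
    (RegularAt.differentiableAt hσ.1) (RegularAt.differentiableAt hτ.1)

lemma logDerivAt_coordSub_zpow {z w : ℂ} (h : w ≠ z) (a : ℤ) :
    logDerivAt w (coordSub z ^ a) = a * (w - z)⁻¹ := by
  have he : (fun x => evalAt x ((coordSub z ^ a : Sec) : RatFunc ℂ)) =ᶠ[nhds w]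
      fun x => (x - z) ^ a := by
    filter_upwards [isOpen_ne.mem_nhds h] with x hx
    exact evalAt_coordSub_zpow hx a
  rw [logDerivAt, (logDeriv_congr_nhds he).self_of_nhds, logDeriv_fun_zpow (by fun_prop),
    logDeriv_apply]
  simp

lemma valueAt_pole {z w : ℂ} {T : Set ℂ} (hw : w ∉ T) (hz : z ∈ T) :
    valueAt z hz (pole w hw) = (z - w)⁻¹ := by
  have hne : z ≠ w := fun h => hw (h ▸ hz)
  -- The pole is the power `-1` of the coordinate `u - w`.
  have h := evalAt_coordSub_zpow hne (-1)
  simp only [zpow_neg, zpow_one, Units.val_inv_eq_inv_val] at h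
  exact h

/-! ### Homomorphisms and derivations of symmetric algebras -/

/-- Suited to `symDer_ι_mul`, which is the Leibniz rule only for a generator on the left. -/
lemma symmetricAlgebra_ι_mul_induction {M : Type} [AddCommGroup M] [Module ℂ M]
    {p : SymmetricAlgebra ℂ M → Prop} (one : p 1) (add : ∀ x y, p x → p y → p (x + y))
    (smul : ∀ (c : ℂ) x, p x → p (c • x))
    (ι_mul : ∀ m x, p x → p (SymmetricAlgebra.ι ℂ M m * x)) (x : SymmetricAlgebra ℂ M) : p x := by
  -- In this stronger form the case of a product is a composition of two implications.
  suffices h : ∀ y, p y → p (x * y) by simpa using h 1 one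
  induction x using SymmetricAlgebra.induction with
  | algebraMap r => intro y hy; simpa [← Algebra.smul_def] using smul r y hy
  | ι m => exact ι_mul m
  | mul a b ha hb => intro y hy; rw [mul_assoc]; exact ha _ (hb _ hy)
  | add a b ha hb => intro y hy; rw [add_mul]; exact add _ _ (ha _ hy) (hb _ hy)

/-- A homomorphism of symmetric algebras intertwines the derivations extending two linear forms
once it does so on the generators. -/
lemma symDer_algHom {M M' : Type} [AddCommGroup M] [Module ℂ M] [AddCommGroup M'] [Module ℂ M']
    (φ : M →ₗ[ℂ] ℂ) (φ' : M' →ₗ[ℂ] ℂ) (f : SymmetricAlgebra ℂ M →ₐ[ℂ] SymmetricAlgebra ℂ M')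
    (g : M → M') (c : M → ℂ)
    (hf : ∀ m, f (SymmetricAlgebra.ι ℂ M m) =
      SymmetricAlgebra.ι ℂ M' (g m) - algebraMap ℂ _ (c m))
    (hg : ∀ m, φ' (g m) = φ m) (x : SymmetricAlgebra ℂ M) :
    symDer φ' (f x) = f (symDer φ x) := by
  induction x using symmetricAlgebra_ι_mul_induction with
  | one => simp [symDer_one]
  | add x y hx hy => simp [hx, hy]
  | smul r x hx => simp [hx]
  | ι_mul m x hx =>
    simp only [symDer_ι_mul, map_add, map_mul, map_smul, hf, sub_mul, map_sub, hg, hx,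
      ← Algebra.smul_def]
    abel

lemma mP_anti {S T : Set ℂ} (h : T ⊆ S) : mP S ≤ mP T :=
  fun _ hf => ⟨hf.1, fun z hz => hf.2 z (h hz)⟩

@[simp]
lemma W.incl_ι {S T : Set ℂ} (h : T ⊆ S) (m : mP S) :
    W.incl h (SymmetricAlgebra.ι ℂ (mP S) m) = SymmetricAlgebra.ι ℂ (mP T)
      (Submodule.inclusion (mP_anti h) m) := by
  simp [W.incl]

@[simp]
lemma W.shift_ι {S : Set ℂ} (c z : ℂ) (hz : z ∈ S) (m : mP S) :
    W.shift c z hz (SymmetricAlgebra.ι ℂ (mP S) m) =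
      SymmetricAlgebra.ι ℂ (mP S) m - algebraMap ℂ _ (c * valueAt z hz m) := by
  simp [W.shift, Algebra.smul_def]

/-- The homomorphism `𝕎^S → 𝕎^T` that sends `α` to `α - c α(z)`. -/
def W.shiftIncl {S T : Set ℂ} (c z : ℂ) (hz : z ∈ S) (hT : T ⊆ S) : W S →ₐ[ℂ] W T :=
  (W.incl hT).comp (W.shift c z hz)

lemma W.shiftIncl_ι {S T : Set ℂ} (c z : ℂ) (hz : z ∈ S) (hT : T ⊆ S) (m : mP S) :
    W.shiftIncl c z hz hT (SymmetricAlgebra.ι ℂ (mP S) m) = SymmetricAlgebra.ι ℂ (mP T)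
      (Submodule.inclusion (mP_anti hT) m) -
        algebraMap ℂ _ (c * valueAt z hz m) := by
  simp [W.shiftIncl]

/-- Either composite sends a generator `α` to `α - c α(z) - c' α(z')`, since constants are fixed by
algebra homomorphisms. -/
lemma W.shiftIncl_comm {S T T' R : Set ℂ} {z z' : ℂ} (c c' : ℂ) (hz : z ∈ S) (hz' : z' ∈ S)
    (hT : T ⊆ S) (hT' : T' ⊆ S) (hR : R ⊆ T) (hR' : R ⊆ T') (hzT : z' ∈ T) (hzT' : z ∈ T') :
    (W.shiftIncl c' z' hzT hR).comp (W.shiftIncl c z hz hT) =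
      (W.shiftIncl c z hzT' hR').comp (W.shiftIncl c' z' hz' hT') := by
  apply SymmetricAlgebra.algHom_ext
  ext m
  change W.shiftIncl c' z' hzT hR (W.shiftIncl c z hz hT (SymmetricAlgebra.ι ℂ (mP S) m)) =
    W.shiftIncl c z hzT' hR' (W.shiftIncl c' z' hz' hT' (SymmetricAlgebra.ι ℂ (mP S) m))
  simp only [W.shiftIncl_ι, map_sub, AlgHom.commutes]
  exact sub_right_comm _ _ _

/-- The shift alters generators by constants, which the derivation kills. -/
lemma W.symDer_shiftIncl {S T : Set ℂ} {z z' : ℂ} (c : ℂ) (hz : z ∈ S) (hT : T ⊆ S)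
    (hz' : z' ∈ S) (hzT : z' ∈ T) (x : W S) :
    symDer (-(differentialAt z' hzT)) (W.shiftIncl c z hz hT x) =
      W.shiftIncl c z hz hT (symDer (-(differentialAt z' hz')) x) :=
  symDer_algHom _ _ _ _ _ (W.shiftIncl_ι c z hz hT) (fun _ => rfl) x

lemma W.shiftIncl_comp_incl {S T T' R : Set ℂ} {z : ℂ} (c : ℂ) (hz : z ∈ S) (hT : T ⊆ S)
    (hT' : T' ⊆ S) (hR : R ⊆ T) (hR' : R ⊆ T') (hzT' : z ∈ T') :
    (W.incl hR).comp (W.shiftIncl c z hz hT) = (W.shiftIncl c z hzT' hR').comp (W.incl hT') := by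
  apply SymmetricAlgebra.algHom_ext
  ext m
  change W.incl hR (W.shiftIncl c z hz hT (SymmetricAlgebra.ι ℂ (mP S) m)) =
    W.shiftIncl c z hzT' hR' (W.incl hT' (SymmetricAlgebra.ι ℂ (mP S) m))
  simp only [W.shiftIncl_ι, W.incl_ι, map_sub, AlgHom.commutes]
  rfl

/-- `W.shiftIncl` with coefficients in the lines. -/
def WL.shiftIncl {S T : Set ℂ} (c z : ℂ) (hz : z ∈ S) (hT : T ⊆ S) : WL S →ₐ[ℂ] WL T :=
  Algebra.TensorProduct.map (W.shiftIncl c z hz hT) (AlgHom.id ℂ Lines)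

@[simp]
lemma WL.shiftIncl_tmul {S T : Set ℂ} (c z : ℂ) (hz : z ∈ S) (hT : T ⊆ S) (x : W S) (y : Lines) :
    WL.shiftIncl c z hz hT (x ⊗ₜ y) = W.shiftIncl c z hz hT x ⊗ₜ y := rfl

@[simp]
lemma WL.incl_tmul {S T : Set ℂ} (hT : T ⊆ S) (x : W S) (y : Lines) :
    WL.incl hT (x ⊗ₜ y) = W.incl hT x ⊗ₜ y := rfl

lemma WL.shiftIncl_comm {S T T' R : Set ℂ} {z z' : ℂ} (c c' : ℂ) (hz : z ∈ S) (hz' : z' ∈ S)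
    (hT : T ⊆ S) (hT' : T' ⊆ S) (hR : R ⊆ T) (hR' : R ⊆ T') (hzT : z' ∈ T) (hzT' : z ∈ T')
    (x : WL S) :
    WL.shiftIncl c' z' hzT hR (WL.shiftIncl c z hz hT x) =
      WL.shiftIncl c z hzT' hR' (WL.shiftIncl c' z' hz' hT' x) := by
  induction x using TensorProduct.induction_on with
  | zero => simp
  | add x y hx hy => simp [hx, hy]
  | tmul x y =>
    have h := DFunLike.congr_fun (W.shiftIncl_comm c c' hz hz' hT hT' hR hR' hzT hzT') x
    simp only [AlgHom.comp_apply] at h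
    simp [h]

lemma WL.shiftIncl_incl {S T T' R : Set ℂ} {z : ℂ} (c : ℂ) (hz : z ∈ S) (hT : T ⊆ S)
    (hT' : T' ⊆ S) (hR : R ⊆ T) (hR' : R ⊆ T') (hzT' : z ∈ T') (x : WL S) :
    WL.shiftIncl c z hzT' hR' (WL.incl hT' x) = WL.incl hR (WL.shiftIncl c z hz hT x) := by
  induction x using TensorProduct.induction_on with
  | zero => simp
  | add x y hx hy => simp [hx, hy]
  | tmul x y =>
    have h := DFunLike.congr_fun (W.shiftIncl_comp_incl c hz hT hT' hR hR' hzT') x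
    simp only [AlgHom.comp_apply] at h
    simp [h]

lemma WL.symDer_shiftIncl {S T : Set ℂ} {z z' : ℂ} (c : ℂ) (hz : z ∈ S) (hT : T ⊆ S)
    (hz' : z' ∈ S) (hzT : z' ∈ T) (x : WL S) :
    LinearMap.rTensor Lines (symDer (-(differentialAt z' hzT))) (WL.shiftIncl c z hz hT x) =
      WL.shiftIncl c z hz hT (LinearMap.rTensor Lines (symDer (-(differentialAt z' hz'))) x) := by
  induction x using TensorProduct.induction_on with
  | zero => simp
  | add x y hx hy => simp only [map_add, hx, hy]
  | tmul x y => simp [W.symDer_shiftIncl c hz hT hz' hzT]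

lemma rTensor_symDer_one_tmul_mul {M : Type} [AddCommGroup M] [Module ℂ M] (φ : M →ₗ[ℂ] ℂ)
    (c : Lines) (x : SymmetricAlgebra ℂ M ⊗[ℂ] Lines) :
    LinearMap.rTensor Lines (symDer φ) (((1 : SymmetricAlgebra ℂ M) ⊗ₜ[ℂ] c) * x) =
      ((1 : SymmetricAlgebra ℂ M) ⊗ₜ[ℂ] c) * LinearMap.rTensor Lines (symDer φ) x := by
  induction x using TensorProduct.induction_on with
  | zero => simp
  | add x y hx hy => simp only [mul_add, map_add, hx, hy]
  | tmul x y => simp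

/-! ### The fields at a section -/

/-- The coefficient of `V_λ(z)` at the section `σ`. -/
def vertexCoeff (N : ℕ) (a : ℤ) (z : ℂ) (σ : Sec) : Lines :=
  (evalAt z (σ : RatFunc ℂ) ^ ((N : ℤ) * a)) •
    (du (bExp N (charge σ) a) * sqrtDu z ((N : ℤ) * a))

/-- Separates the three ingredients (section, coefficient, homomorphism) so that each can be
commuted on its own. -/
lemma vertexOp_apply (N : ℕ) (a : ℤ) (z : ℂ) {S T : Set ℂ} (hz : z ∈ S) (hT : T ⊆ S)
    (hzT : z ∉ T) (ρ : State N S) (τ : Sec) :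
    (vertexOp N a z hz hT hzT ρ : Maps T) τ =
      ((1 : W T) ⊗ₜ[ℂ] vertexCoeff N a z (coordSub z ^ a * τ)) *
        WL.shiftIncl (lam N a) z hz hT ((ρ : Maps S) (coordSub z ^ a * τ)) := by
  have h : ∀ x : WL S, WL.incl hT (Algebra.TensorProduct.map (W.shift (lam N a) z hz)
      (AlgHom.id ℂ Lines) x) = WL.shiftIncl (lam N a) z hz hT x := by
    intro x
    induction x using TensorProduct.induction_on with
    | zero => simp
    | add x y hx hy => simp only [map_add, hx, hy]
    | tmul x y => rfl
  simp only [vertexOp, flatPlus, flatMinus, LinearMap.coe_mk, AddHom.coe_mk, map_mul, h,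
    ← mul_assoc, WL.incl_tmul, map_one, Algebra.TensorProduct.tmul_mul_tmul, vertexCoeff,
    mul_smul_comm, mul_one]

/-- Groups `ε(z)` with the scalar part of `ι(z)` into one multiplier: a vertex operator at another
point affects each of the two, but not their combination. -/
lemma current_apply (N : ℕ) (z : ℂ) {S T : Set ℂ} (hz : z ∈ S) (hT : T ⊆ S) (hzT : z ∉ T)
    (ρ : State N S) (σ : Sec) :
    (current N z hz hT hzT ρ : Maps T) σ =
      ((1 : W T) ⊗ₜ[ℂ] du 1) *
        (WL.incl hT (LinearMap.rTensor Lines (symDer (-(differentialAt z hz))) ((ρ : Maps S) σ)) +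
          ((SymmetricAlgebra.ι ℂ (mP T) (pole z hzT) -
            algebraMap ℂ (W T) (((Real.sqrt N : ℝ) : ℂ) * logDerivAt z σ)) ⊗ₜ[ℂ] 1) *
            WL.incl hT ((ρ : Maps S) σ)) := by
  have h1 : SymmetricAlgebra.ι ℂ (mP T) (pole z hzT) ⊗ₜ[ℂ] du 1 =
      ((1 : W T) ⊗ₜ[ℂ] du 1) * (SymmetricAlgebra.ι ℂ (mP T) (pole z hzT) ⊗ₜ[ℂ] (1 : Lines)) := by
    simp
  have h2 : ∀ c : ℂ, ((algebraMap ℂ (W T) c) ⊗ₜ[ℂ] (1 : Lines)) = algebraMap ℂ (WL T) c :=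
    fun c => rfl
  have h3 : ∀ (c : ℂ) (x : WL T), c • x = algebraMap ℂ (WL T) c * x :=
    fun c x => Algebra.smul_def c x
  simp only [current, iotaField, iotaValue, epsilonField, LinearMap.add_apply, LinearMap.coe_mk,
    AddHom.coe_mk, Submodule.coe_add, Pi.add_apply, LinearMap.comp_apply, LinearMap.mulLeft_apply,
    LinearMap.sub_apply, LinearMap.smul_apply, LinearMap.id_apply]
  generalize ((Real.sqrt N : ℝ) : ℂ) * logDerivAt z σ = c
  rw [map_mul (WL.incl hT), map_sub (WL.incl hT), map_smul (WL.incl hT), WL.incl_tmul, map_one, h1,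
    TensorProduct.sub_tmul, h2, h3]
  ring

/-! ### Commutation -/

lemma du_mul (m n : ℤ) : du m * du n = du (m + n) := by
  simp [du, AddMonoidAlgebra.single_mul_single]

/-- The only source of the sign: the factor `u - z` evaluated at `z'` against `u - z'` evaluated at
`z`. -/
lemma vertexCoeff_comm (N : ℕ) (a a' : ℤ) {z z' : ℂ} (h : z' ≠ z) {τ : Sec}
    (hz : RegNonvanishing z (coordSub z ^ a * (coordSub z' ^ a' * τ)))
    (hz' : RegNonvanishing z' (coordSub z ^ a * (coordSub z' ^ a' * τ))) :
    vertexCoeff N a' z' (coordSub z' ^ a' * τ) *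
        vertexCoeff N a z (coordSub z ^ a * (coordSub z' ^ a' * τ)) =
      ((-1 : ℂ) ^ ((N : ℤ) * a * a')) •
        (vertexCoeff N a z (coordSub z ^ a * τ) *
          vertexCoeff N a' z' (coordSub z ^ a * (coordSub z' ^ a' * τ))) := by
  have r1 : RegNonvanishing z' (coordSub z' ^ a' * τ) := hz'.of_coordSub_zpow_mul h
  -- The section `τ` itself may have a zero or a pole at `z`, so the power of `u - z` stays attached
  -- to it and only that of `u - z'` is cancelled.
  have r2 : RegNonvanishing z (coordSub z ^ a * τ) := by
    rw [mul_left_comm] at hz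
    exact hz.of_coordSub_zpow_mul h.symm
  have e1 : evalAt z' ((coordSub z ^ a * (coordSub z' ^ a' * τ) : Sec) : RatFunc ℂ) =
      (z' - z) ^ a * evalAt z' ((coordSub z' ^ a' * τ : Sec) : RatFunc ℂ) := by
    rw [(regNonvanishing_coordSub_zpow h a).evalAt_mul r1, evalAt_coordSub_zpow h]
  have e2 : evalAt z ((coordSub z ^ a * (coordSub z' ^ a' * τ) : Sec) : RatFunc ℂ) =
      (z - z') ^ a' * evalAt z ((coordSub z ^ a * τ : Sec) : RatFunc ℂ) := by
    rw [mul_left_comm, (regNonvanishing_coordSub_zpow h.symm a').evalAt_mul r2,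
      evalAt_coordSub_zpow h.symm]
  have hd : ∀ x y : Lines, ∀ m n m' n' : ℤ, m + n = m' + n' →
      (du m * x) * (du n * y) = (du m' * y) * (du n' * x) := by
    intro x y m n m' n' hmn
    rw [mul_mul_mul_comm, mul_mul_mul_comm (du m'), du_mul, du_mul, hmn, mul_comm x]
  simp only [vertexCoeff, e1, e2, smul_mul_smul_comm, smul_smul]
  -- With `l` the charge of the section at which the state is read, the total power of `du` in
  -- either order is `-N (l (a + a') + a ^ 2 + a a' + a' ^ 2)`, symmetric in `a` and `a'`.
  rw [hd _ _ _ _ (bExp N (charge (coordSub z ^ a * τ)) a)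
    (bExp N (charge (coordSub z ^ a * (coordSub z' ^ a' * τ))) a')
    (by simp only [bExp, charge_mul, charge_coordSub_zpow]; ring)]
  congr 1
  have hs : z - z' = (-1) * (z' - z) := by ring
  rw [hs]
  simp only [mul_zpow, ← zpow_mul]
  rw [show a' * ((N : ℤ) * a) = (N : ℤ) * a * a' by ring,
    show a * ((N : ℤ) * a') = (N : ℤ) * a * a' by ring]
  ring

/-- The case of interest is `S = {z, z'}`, `T = {z'}`, `T' = {z}`, `R = ∅`. -/
lemma vertexOp_comm (N : ℕ) (a a' : ℤ) {z z' : ℂ} (h : z' ≠ z) {S T T' R : Set ℂ}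
    (hz : z ∈ S) (hz' : z' ∈ S) (hT : T ⊆ S) (hT' : T' ⊆ S) (hR : R ⊆ T) (hR' : R ⊆ T')
    (hzT : z' ∈ T) (hzT' : z ∈ T') (hnT : z ∉ T) (hnT' : z' ∉ T') (hnR : z ∉ R) (hnR' : z' ∉ R) :
    vertexOp N a' z' hzT hR hnR' ∘ₗ vertexOp N a z hz hT hnT =
      ((-1 : ℂ) ^ ((N : ℤ) * a * a')) •
        (vertexOp N a z hzT' hR' hnR ∘ₗ vertexOp N a' z' hz' hT' hnT') := by
  ext ρ τ
  simp only [LinearMap.comp_apply, LinearMap.smul_apply, Submodule.coe_smul, Pi.smul_apply,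
    vertexOp_apply, map_mul, WL.shiftIncl_tmul, map_one, ← mul_assoc,
    Algebra.TensorProduct.tmul_mul_tmul, mul_one, ← smul_mul_assoc, ← TensorProduct.tmul_smul]
  simp only [mul_assoc]
  -- Both orders now read the state at the same section.
  rw [mul_left_comm (coordSub z' ^ a')]
  -- Where the state vanishes both sides are zero; elsewhere its support condition gives the
  -- regularity at `z` and `z'` that `vertexCoeff_comm` needs.
  by_cases h0 : (ρ : Maps S) (coordSub z ^ a * (coordSub z' ^ a' * τ)) = 0
  · simp [h0]
  · have hr := ρ.2.2.2 _ h0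
    rw [WL.shiftIncl_comm (lam N a) (lam N a') hz hz' hT hT' hR hR' hzT hzT',
      vertexCoeff_comm N a a' h (hr z hz) (hr z' hz')]
    simp only [smul_mul_assoc, mul_assoc]

lemma current_comm_vertexOp (N : ℕ) (a : ℤ) {z z' : ℂ} (h : z' ≠ z) {S T T' R : Set ℂ}
    (hz : z ∈ S) (hz' : z' ∈ S) (hT : T ⊆ S) (hT' : T' ⊆ S) (hR : R ⊆ T) (hR' : R ⊆ T')
    (hzT : z' ∈ T) (hzT' : z ∈ T') (hnT : z ∉ T) (hnT' : z' ∉ T') (hnR : z ∉ R) (hnR' : z' ∉ R) :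
    current N z' hzT hR hnR' ∘ₗ vertexOp N a z hz hT hnT =
      vertexOp N a z hzT' hR' hnR ∘ₗ current N z' hz' hT' hnT' := by
  ext ρ τ
  simp only [LinearMap.comp_apply, vertexOp_apply, current_apply]
  by_cases h0 : (ρ : Maps S) (coordSub z ^ a * τ) = 0
  · simp [h0]
  have hr : RegNonvanishing z' τ := (ρ.2.2.2 _ h0 z' hz').of_coordSub_zpow_mul h
  -- The shift adds `λ / (z' - z)` to the generator `1 / (u - z')`, while the factor `(u - z) ^ a`
  -- contributes `a / (z' - z)` to the logarithmic derivative. After multiplication by `-√N` the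
  -- latter cancels the former.
  have hp : WL.shiftIncl (lam N a) z hzT' hR'
      ((SymmetricAlgebra.ι ℂ (mP T') (pole z' hnT') - algebraMap ℂ (W T')
        (((Real.sqrt N : ℝ) : ℂ) * logDerivAt z' (coordSub z ^ a * τ))) ⊗ₜ[ℂ] (1 : Lines)) =
      (SymmetricAlgebra.ι ℂ (mP R) (pole z' hnR') - algebraMap ℂ (W R)
        (((Real.sqrt N : ℝ) : ℂ) * logDerivAt z' τ)) ⊗ₜ[ℂ] (1 : Lines) := by
    rw [WL.shiftIncl_tmul, map_sub, W.shiftIncl_ι, AlgHom.commutes, valueAt_pole, sub_sub,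
      ← map_add, logDerivAt_mul (regNonvanishing_coordSub_zpow h a) hr,
      logDerivAt_coordSub_zpow h, lam]
    have hs : (z - z')⁻¹ = -(z' - z)⁻¹ := by rw [← inv_neg, neg_sub]
    rw [hs]
    congr 3
    ring_nf
  rw [rTensor_symDer_one_tmul_mul, WL.symDer_shiftIncl (lam N a) hz hT hz' hzT]
  rw [map_mul (WL.incl hR), map_mul (WL.shiftIncl (lam N a) z hzT' hR'),
    map_add (WL.shiftIncl (lam N a) z hzT' hR'), map_mul (WL.shiftIncl (lam N a) z hzT' hR'),
    map_mul (WL.incl hR), hp, WL.shiftIncl_incl (lam N a) hz hT hT' hR hR' hzT',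
    WL.shiftIncl_incl (lam N a) hz hT hT' hR hR' hzT', WL.incl_tmul, WL.shiftIncl_tmul, map_one,
    map_one]
  ring

end LatticeField

end

theorem mainTheorem12 :
    (∀ (N : ℕ), 0 < N → ∀ (z z' : ℂ) (h : z' ≠ z),
      (∀ a : ℤ,
        LatticeField.current N z' (S := {z'}) (T := ∅) (by simp) (by simp) (by simp) ∘ₗ
          LatticeField.vertexOp N a z (S := {z, z'}) (T := {z'}) (by simp) (by simp)
            (by simpa using h.symm) =
        LatticeField.vertexOp N a z (S := {z}) (T := ∅) (by simp) (by simp) (by simp) ∘ₗ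
          LatticeField.current N z' (S := {z, z'}) (T := {z}) (by simp) (by simp)
            (by simpa using h)) ∧
      (∀ a a' : ℤ,
        LatticeField.vertexOp N a' z' (S := {z'}) (T := ∅) (by simp) (by simp) (by simp) ∘ₗ
          LatticeField.vertexOp N a z (S := {z, z'}) (T := {z'}) (by simp) (by simp)
            (by simpa using h.symm) =
        ((-1 : ℂ) ^ ((N : ℤ) * a * a')) •
          (LatticeField.vertexOp N a z (S := {z}) (T := ∅) (by simp) (by simp) (by simp) ∘ₗ
            LatticeField.vertexOp N a' z' (S := {z, z'}) (T := {z}) (by simp) (by simp)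
              (by simpa using h)))) ∧
    (∀ (z z' : ℂ) (h : z' ≠ z) (a a' : ℤ), (a = 1 ∨ a = -1) → (a' = 1 ∨ a' = -1) →
      LatticeField.vertexOp 1 a' z' (S := {z'}) (T := ∅) (by simp) (by simp) (by simp) ∘ₗ
        LatticeField.vertexOp 1 a z (S := {z, z'}) (T := {z'}) (by simp) (by simp)
          (by simpa using h.symm) =
      (-1 : ℂ) • (LatticeField.vertexOp 1 a z (S := {z}) (T := ∅) (by simp) (by simp) (by simp) ∘ₗ
            LatticeField.vertexOp 1 a' z' (S := {z, z'}) (T := {z}) (by simp) (by simp)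
              (by simpa using h))) := by
  refine ⟨fun N _ z z' h => ⟨fun a => ?_, fun a a' => ?_⟩, fun z z' h a a' ha ha' => ?_⟩
  · exact LatticeField.current_comm_vertexOp N a h _ (by simp) _ _ _ _ _ _ _ _ _ _
  · exact LatticeField.vertexOp_comm N a a' h _ (by simp) _ _ _ _ _ _ _ _ _ _
  -- The exponent is `1` or `-1`, hence odd.
  · have hs : (-1 : ℂ) ^ (((1 : ℕ) : ℤ) * a * a') = -1 := by
      rcases ha with rfl | rfl <;> rcases ha' with rfl | rfl <;> norm_num
    rw [← hs]
    exact LatticeField.vertexOp_comm 1 a a' h _ (by simp) _ _ _ _ _ _ _ _ _ _
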